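/- Let $\Omega\subset\mathbb R^d$ ($d\ge 1$) be a bounded domain, $\tau>0$, and $\psi\in C([0,\tau])$. Let $\lambda_1\le\lambda_2\le\dots$ and $(\varphi_n)_{n\ge1}$ be the eigenvalues and an orthonormal basis of $L^2(\Omega)$ of corresponding eigenfunctions of $-\Delta$ on $\Omega$ with homogeneous Dirichlet boundary condition, understood in the weak sense: $\varphi_n\in H^1_0(\Omega)$ and $\int_\Omega\nabla\varphi_n\cdot\nabla\eta=\lambda_n\int_\Omega\varphi_n\eta$ for all $\eta\in C_c^\infty(\Omega)$. (Then $\lambda_1>0$ and $\lambda_n\to\infty$.) Assume that there are $\tau_0\in[0,\tau)$ and $\kappa_1>0$ with $|\psi|\ge\kappa_1$ on $[\tau_0,\tau]$, and that one of the following holds: (i) $\psi$ does not change sign on $[0,\tau]$ (that is, $\psi\ge0$ on $[0,\tau]$ or $\psi\le0$ on $[0,\tau]$); (ii) $\psi$ changes sign on $[0,\tau]$, is differentiable on $[0,\tau]$ with $|\psi'|\le\kappa_2$ for some constant $\kappa_2>0$, and $|\psi(t)|\le\frac{(\tau-\tau_0)^2\kappa_1}{4\tau\tau_0}$ for all $t\in[0,\tau]$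 with $\psi(t)\psi(\tau)\le0$. Put $$\mu_n=\int_0^\tau e^{-\lambda_n(\tau-s)}(\tau-s)\psi(s)\,ds,\qquad \mathbb T g=\sum_{n=1}^\infty\mu_n\langle g,\varphi_n\rangle\varphi_n\quad(g\in L^2(\Omega)),$$ and, for $\varrho,p>0$, $$S_{\varrho,p}=\Big\{g\in L^2(\Omega):\sum_{n=1}^\infty\lambda_n^{2p}|\langle g,\varphi_n\rangle|^2\le\varrho^2\Big\}.$$ Then there is a constant $C>0$ such that $|\mu_n|\ge C/\lambda_n^2$ for all $n$. Moreover, for every such constant $C$, all $\varrho,p>0$ and all $f,h\in L^2(\Omega)$ with $f\in S_{\varrho,p}$ and $\mathbb Tf=h$, $$\|f\|_{L^2(\Omega)}\le C^{-\frac{p}{p+2}}\,\varrho^{\frac{2}{p+2}}\,\|h\|_{L^2(\Omega)}^{\frac{p}{p+2}}.$$ -/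

import Mathlib

open MeasureTheory Filter Topology Set
open scoped ContDiff

noncomputable section

/-- The real Hilbert space `L²(Ω)`, for `Ω ⊆ ℝᵈ` with Lebesgue measure. -/
abbrev L2 {d : ℕ} (Ω : Set (EuclideanSpace ℝ (Fin d))) : Type :=
  Lp ℝ 2 (volume.restrict Ω)

/-- `η` is a test function on `Ω`, i.e. `η ∈ C_c^∞(Ω)`, extended by zero to `ℝᵈ`. -/
structure IsTestFunction {d : ℕ} (Ω : Set (EuclideanSpace ℝ (Fin d)))
    (η : EuclideanSpace ℝ (Fin d) → ℝ) : Prop where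
  contDiff : ContDiff ℝ ∞ η
  hasCompactSupport : HasCompactSupport η
  tsupport_subset : tsupport η ⊆ Ω

/-- `u ∈ H₀¹(Ω)` with weak gradient `G ∈ L²(Ω; ℝᵈ)`. Here `H₀¹(Ω)` is the closure of `C_c^∞(Ω)` in
the `H¹(Ω)`-norm: some test functions `η k` satisfy `η k → u` and `∇ (η k) → G` in `L²(Ω)`. -/
structure HasH10Gradient {d : ℕ} (Ω : Set (EuclideanSpace ℝ (Fin d)))
    (u : EuclideanSpace ℝ (Fin d) → ℝ)
    (G : EuclideanSpace ℝ (Fin d) → EuclideanSpace ℝ (Fin d)) : Prop where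
  memLp : MemLp u 2 (volume.restrict Ω)
  memLp_grad : MemLp G 2 (volume.restrict Ω)
  approx : ∃ η : ℕ → EuclideanSpace ℝ (Fin d) → ℝ,
    (∀ k, IsTestFunction Ω (η k)) ∧
    Tendsto (fun k => eLpNorm (fun x => η k x - u x) 2 (volume.restrict Ω)) atTop (𝓝 0) ∧
    Tendsto (fun k => eLpNorm (fun x => gradient (η k) x - G x) 2 (volume.restrict Ω))
      atTop (𝓝 0)

/-- `v` solves `-Δ v = ev • v` in `Ω`, `v = 0` on `∂Ω`, in the weak sense:
`v ∈ H₀¹(Ω)` and `∫_Ω ∇v · ∇η = ev ∫_Ω v η` for all test functions `η`. -/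
def IsDirichletSolution {d : ℕ} (Ω : Set (EuclideanSpace ℝ (Fin d))) (ev : ℝ) (v : L2 Ω) : Prop :=
  ∃ G : EuclideanSpace ℝ (Fin d) → EuclideanSpace ℝ (Fin d),
    HasH10Gradient Ω v G ∧
    ∀ η : EuclideanSpace ℝ (Fin d) → ℝ, IsTestFunction Ω η →
      ∫ x in Ω, inner ℝ (G x) (gradient η x) = ev * ∫ x in Ω, v x * η x

/-- `lam 0 ≤ lam 1 ≤ …` and the orthonormal basis `φ` of `L²(Ω)` form an eigensystem of the
Dirichlet Laplacian `-Δ` on `Ω`. (The eigenvalues are numbered from `0`. On a bounded `Ω` their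
positivity and divergence to `+∞` are consequences, hence not required here.) -/
structure IsDirichletEigensystem {d : ℕ} (Ω : Set (EuclideanSpace ℝ (Fin d)))
    (lam : ℕ → ℝ) (φ : HilbertBasis ℕ ℝ (L2 Ω)) : Prop where
  monotone : Monotone lam
  eigen : ∀ n, IsDirichletSolution Ω (lam n) (φ n)

/-- `ψ` takes both a negative and a positive value on `[0, τ]`. -/
def ChangesSign (τ : ℝ) (ψ : ℝ → ℝ) : Prop :=
  ∃ s ∈ Icc 0 τ, ∃ t ∈ Icc 0 τ, ψ s < 0 ∧ 0 < ψ t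

/-- The standing assumption on the time-dependent factor `ψ` of the source.
If `τ₀ = 0`, then the continuous function `ψ` has no zero in `[0, τ]`, so that it does not change
sign and the quotient by `4 * τ * τ₀` plays no role. -/
def TimeFactorAssumption (τ : ℝ) (ψ : ℝ → ℝ) : Prop :=
  ∃ τ₀ ∈ Ico 0 τ, ∃ κ₁ > 0, (∀ t ∈ Icc τ₀ τ, κ₁ ≤ |ψ t|) ∧
    (¬ ChangesSign τ ψ ∨
      (DifferentiableOn ℝ ψ (Icc 0 τ) ∧
        (∃ κ₂ > 0, ∀ t ∈ Icc 0 τ, |derivWithin ψ (Icc 0 τ) t| ≤ κ₂) ∧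
        ∀ t ∈ Icc 0 τ, ψ t * ψ τ ≤ 0 → |ψ t| ≤ (τ - τ₀) ^ 2 * κ₁ / (4 * τ * τ₀)))

/-- `∫_0^t e^{-ev (t-s)} (t-s) ψ(s) ds`; this is `μ_n(t)` for `ev = λ_n`. -/
def mu (ψ : ℝ → ℝ) (ev t : ℝ) : ℝ :=
  ∫ s in (0 : ℝ)..t, Real.exp (-ev * (t - s)) * (t - s) * ψ s

/-- The operator `T g = ∑ₙ μ_n(τ) ⟨g, φ_n⟩ φ_n` on `L²(Ω)`; it maps the source `g` to the final
value `u(τ)` of the solution `u(t) = ∑ₙ μ_n(t) ⟨g, φ_n⟩ φ_n` of the forward problem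
`u_tt - 2 Δ u_t + Δ² u = ψ(t) g`, with `u = Δ u = 0` on `∂Ω` and `u = u_t = 0` at time `0`. -/
def sourceToFinal {d : ℕ} {Ω : Set (EuclideanSpace ℝ (Fin d))} (τ : ℝ) (ψ : ℝ → ℝ)
    (lam : ℕ → ℝ) (φ : HilbertBasis ℕ ℝ (L2 Ω)) (g : L2 Ω) : L2 Ω :=
  ∑' n, (mu ψ (lam n) τ * inner ℝ g (φ n)) • φ n

/-- The source set `S_{ϱ,p}`: all `g ∈ L²(Ω)` with `∑ₙ λ_n^{2p} |⟨g, φ_n⟩|² ≤ ϱ²`; in particular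
the series converges. -/
def sourceSet {d : ℕ} {Ω : Set (EuclideanSpace ℝ (Fin d))} (lam : ℕ → ℝ)
    (φ : HilbertBasis ℕ ℝ (L2 Ω)) (ϱ p : ℝ) : Set (L2 Ω) :=
  {g | Summable (fun n => lam n ^ (2 * p) * |inner ℝ g (φ n)| ^ 2) ∧
    ∑' n, lam n ^ (2 * p) * |inner ℝ g (φ n)| ^ 2 ≤ ϱ ^ 2}

end

/-! The kernel `e^{-λ(τ-s)} (τ-s)` has mass of order `λ⁻²` within distance `1/λ` of `s = τ`, where
`|ψ| ≥ κ₁` and `ψ` keeps one sign. Values of `ψ` of the other sign occur only before `τ₀`; there the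
kernel is at most `τ e^{-λ(τ-τ₀)}`, and the smallness of `ψ` lets them cancel at most half of the
late contribution, uniformly in `λ` (`half_integral_kernel_le_mu`). The constant needs a positive
lower bound for the eigenvalues, which the Poincaré inequality supplies (`IsDirichletSolution.pos`).

Stability is then Hölder interpolation of the coefficients of `f` between the weights `λ^{2p}`
(source condition) and `λ⁻⁴` (dominated by the coefficients of `h`), see `tsum_sq_le_interpolation`.
-/

/-! ### Lower bound for `mu` -/

theorem intervalIntegrable_kernel_mul {τ a b lam : ℝ} {ψ : ℝ → ℝ} (hψ : ContinuousOn ψ (Icc 0 τ))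
    (ha : 0 ≤ a) (hab : a ≤ b) (hb : b ≤ τ) :
    IntervalIntegrable (fun s => Real.exp (-lam * (τ - s)) * (τ - s) * ψ s) volume a b := by
  apply ContinuousOn.intervalIntegrable
  rw [uIcc_of_le hab]
  exact (by fun_prop : Continuous fun s => Real.exp (-lam * (τ - s)) * (τ - s)).continuousOn.mul
    (hψ.mono (Icc_subset_Icc ha hb))

theorem integral_sub_self (τ b : ℝ) : ∫ s in (τ - b)..τ, (τ - s) = b ^ 2 / 2 := by
  rw [intervalIntegral.integral_comp_sub_left (fun x => x) τ]
  simp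

/-- The kernel integral over the last `b` units of time is at least `e^{-λb} b² / 2`. -/
theorem exp_mul_sq_le_integral_kernel {τ b lam : ℝ} (hlam : 0 ≤ lam) (hb : 0 ≤ b) :
    Real.exp (-lam * b) * (b ^ 2 / 2) ≤
      ∫ s in (τ - b)..τ, Real.exp (-lam * (τ - s)) * (τ - s) := by
  rw [← integral_sub_self τ b, ← intervalIntegral.integral_const_mul]
  refine intervalIntegral.integral_mono_on (by linarith)
    (Continuous.intervalIntegrable (by fun_prop) _ _)
    (Continuous.intervalIntegrable (by fun_prop) _ _) fun s hs => ?_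
  refine mul_le_mul_of_nonneg_right (Real.exp_le_exp.2 ?_) (by linarith [hs.2])
  nlinarith [hs.1, hs.2]

theorem integral_kernel_mono {τ a b lam : ℝ} (hb : 0 ≤ b) (hba : b ≤ a) :
    ∫ s in (τ - b)..τ, Real.exp (-lam * (τ - s)) * (τ - s) ≤
      ∫ s in (τ - a)..τ, Real.exp (-lam * (τ - s)) * (τ - s) := by
  refine intervalIntegral.integral_mono_interval (by linarith) (by linarith) le_rfl ?_
    (Continuous.intervalIntegrable (by fun_prop) _ _)
  filter_upwards [ae_restrict_mem measurableSet_Ioc] with s hs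
  exact mul_nonneg (Real.exp_pos _).le (by linarith [hs.2])

/-- For `λ ≥ m > 0`, the kernel integral over the last `a` units of time decays like `λ⁻²`. -/
theorem const_div_sq_le_integral_kernel {τ a m lam : ℝ} (ha : 0 < a) (hm : 0 < m) (h : m ≤ lam) :
    Real.exp (-1) * (min (a * m) 1 ^ 2 / 2) / lam ^ 2 ≤
      ∫ s in (τ - a)..τ, Real.exp (-lam * (τ - s)) * (τ - s) := by
  have hlam : 0 < lam := hm.trans_le h
  have hc : 0 ≤ min (a * m) 1 := le_min (by positivity) zero_le_one
  -- A window of length `min (a * m) 1 / lam` keeps the exponential above `e^{-1}`; the minimum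
  -- makes it fit into length `a` for every `lam ≥ m`.
  have hb : 0 ≤ min (a * m) 1 / lam := by positivity
  have hba : min (a * m) 1 / lam ≤ a := by
    rw [div_le_iff₀ hlam]
    exact (min_le_left _ _).trans (by gcongr)
  refine le_trans ?_ ((exp_mul_sq_le_integral_kernel hlam.le hb).trans (integral_kernel_mono hb hba))
  have h1 : Real.exp (-1) ≤ Real.exp (-lam * (min (a * m) 1 / lam)) := by
    refine Real.exp_le_exp.2 ?_
    have : -lam * (min (a * m) 1 / lam) = -min (a * m) 1 := by field_simp
    linarith [min_le_right (a * m) 1]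
  calc Real.exp (-1) * (min (a * m) 1 ^ 2 / 2) / lam ^ 2
      = Real.exp (-1) * ((min (a * m) 1 / lam) ^ 2 / 2) := by field_simp
    _ ≤ _ := by gcongr

/-- If `ψ ≥ κ` on `[τ₀, τ]` and `ψ ≥ -M` on `[0, τ₀]` with `M` small, then `mu` is bounded below by
half of the contribution of `[τ₀, τ]`. -/
theorem half_integral_kernel_le_mu {τ τ₀ κ M lam : ℝ} {ψ : ℝ → ℝ} (hψ : ContinuousOn ψ (Icc 0 τ))
    (hτ₀ : τ₀ ∈ Ico 0 τ) (hM : 0 ≤ M) (hMκ : M * (τ * τ₀) ≤ (τ - τ₀) ^ 2 * κ / 4)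
    (hκ : 0 ≤ κ) (hlate : ∀ t ∈ Icc τ₀ τ, κ ≤ ψ t) (hearly : ∀ t ∈ Icc 0 τ₀, -M ≤ ψ t)
    (hlam : 0 ≤ lam) :
    κ / 2 * ∫ s in τ₀..τ, Real.exp (-lam * (τ - s)) * (τ - s) ≤ mu ψ lam τ := by
  obtain ⟨h0, h1⟩ := hτ₀
  have hsplit := intervalIntegral.integral_add_adjacent_intervals
    (intervalIntegrable_kernel_mul (lam := lam) hψ le_rfl h0 h1.le)
    (intervalIntegrable_kernel_mul (lam := lam) hψ h0 h1.le le_rfl)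
  have hE := (Real.exp_pos (-lam * (τ - τ₀))).le
  have hfirst : ∫ _ in (0 : ℝ)..τ₀, -(M * (τ * Real.exp (-lam * (τ - τ₀)))) ≤
      ∫ s in (0 : ℝ)..τ₀, Real.exp (-lam * (τ - s)) * (τ - s) * ψ s := by
    refine intervalIntegral.integral_mono_on h0 (by simp)
      (intervalIntegrable_kernel_mul hψ le_rfl h0 h1.le) fun s hs => ?_
    have hs' : 0 ≤ τ - s := by linarith [hs.2]
    have hk : Real.exp (-lam * (τ - s)) * (τ - s) ≤ Real.exp (-lam * (τ - τ₀)) * τ := by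
      refine mul_le_mul (Real.exp_le_exp.2 ?_) (by linarith [hs.1]) hs' hE
      nlinarith [hs.2]
    have hk0 : 0 ≤ Real.exp (-lam * (τ - s)) * (τ - s) := mul_nonneg (Real.exp_pos _).le hs'
    calc -(M * (τ * Real.exp (-lam * (τ - τ₀))))
        = -(Real.exp (-lam * (τ - τ₀)) * τ * M) := by ring
      _ ≤ -(Real.exp (-lam * (τ - s)) * (τ - s) * M) :=
        neg_le_neg (mul_le_mul_of_nonneg_right hk hM)
      _ = Real.exp (-lam * (τ - s)) * (τ - s) * (-M) := by ring
      _ ≤ _ := mul_le_mul_of_nonneg_left (hearly s hs) hk0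
  have hsecond : ∫ s in τ₀..τ, Real.exp (-lam * (τ - s)) * (τ - s) * κ ≤
      ∫ s in τ₀..τ, Real.exp (-lam * (τ - s)) * (τ - s) * ψ s := by
    refine intervalIntegral.integral_mono_on h1.le (Continuous.intervalIntegrable (by fun_prop) _ _)
      (intervalIntegrable_kernel_mul hψ h0 h1.le le_rfl) fun s hs => ?_
    exact mul_le_mul_of_nonneg_left (hlate s hs)
      (mul_nonneg (Real.exp_pos _).le (by linarith [hs.2]))
  -- With `E = e^{-λ(τ-τ₀)}`, half of the late part is at least `κ/2 · E (τ-τ₀)²/2`, which by `hMκ`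
  -- covers the early loss `M τ τ₀ E`; this is the origin of the factor 4.
  have hlow := exp_mul_sq_le_integral_kernel (τ := τ) hlam (sub_nonneg.2 h1.le)
  rw [sub_sub_cancel] at hlow
  rw [intervalIntegral.integral_mul_const] at hsecond
  rw [intervalIntegral.integral_const, smul_eq_mul, sub_zero] at hfirst
  rw [mu, ← hsplit]
  have h2 := mul_le_mul_of_nonneg_right hMκ hE
  have h3 := mul_le_mul_of_nonneg_left hlow hκ
  linarith

/-- Uniformity in `lam` makes the series defining `sourceToFinal` converge. -/
theorem abs_mu_le {τ B lam : ℝ} {ψ : ℝ → ℝ} (hτ : 0 ≤ τ) (hB : ∀ t ∈ Icc 0 τ, |ψ t| ≤ B)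
    (hlam : 0 ≤ lam) : |mu ψ lam τ| ≤ τ * B * τ := by
  have h := intervalIntegral.norm_integral_le_of_norm_le_const (a := 0) (b := τ) (C := τ * B)
    (f := fun s => Real.exp (-lam * (τ - s)) * (τ - s) * ψ s) fun s hs => by
      rw [uIoc_of_le hτ] at hs
      have hs' : 0 ≤ τ - s := by linarith [hs.2]
      rw [norm_mul, Real.norm_eq_abs, Real.norm_eq_abs, abs_of_nonneg (by positivity)]
      refine mul_le_mul ?_ (hB s ⟨hs.1.le, hs.2⟩) (abs_nonneg _) hτ
      calc Real.exp (-lam * (τ - s)) * (τ - s) ≤ 1 * τ :=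
            mul_le_mul (Real.exp_le_one_iff.2 (by nlinarith)) (by linarith [hs.1]) hs' zero_le_one
        _ = τ := one_mul τ
  rwa [sub_zero, abs_of_nonneg hτ] at h

theorem mu_neg (ψ : ℝ → ℝ) (lam τ : ℝ) : mu (-ψ) lam τ = -mu ψ lam τ := by
  simp [mu]

/-- Both alternatives of the standing assumption bound `ψ` where its sign differs from the final
one. -/
theorem TimeFactorAssumption.exists_bound {τ : ℝ} {ψ : ℝ → ℝ} (h : TimeFactorAssumption τ ψ) :
    ∃ τ₀ ∈ Ico 0 τ, ∃ κ > 0, ∃ M ≥ 0, M * (τ * τ₀) ≤ (τ - τ₀) ^ 2 * κ / 4 ∧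
      (∀ t ∈ Icc τ₀ τ, κ ≤ |ψ t|) ∧ ∀ t ∈ Icc 0 τ, ψ t * ψ τ ≤ 0 → |ψ t| ≤ M := by
  obtain ⟨τ₀, hτ₀, κ, hκ, hlate, hsign⟩ := h
  have hτ : 0 < τ := hτ₀.1.trans_lt hτ₀.2
  refine ⟨τ₀, hτ₀, κ, hκ, ?_⟩
  rcases hsign with hsign | ⟨-, -, hM⟩
  -- Without a sign change `M = 0` works: a nonzero value of sign opposite to `ψ τ` would be a sign
  -- change.
  · refine ⟨0, le_rfl, by rw [zero_mul]; positivity, hlate, fun t ht htτ => ?_⟩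
    have hψτ : ψ τ ≠ 0 := abs_pos.1 (hκ.trans_le (hlate τ ⟨hτ₀.2.le, le_rfl⟩))
    have hτmem : τ ∈ Icc 0 τ := ⟨hτ.le, le_rfl⟩
    rw [abs_nonpos_iff]
    by_contra hne
    refine hsign ?_
    rcases (mul_ne_zero hne hψτ).lt_of_le htτ |> mul_neg_iff.1 with h | h
    · exact ⟨τ, hτmem, t, ht, h.2, h.1⟩
    · exact ⟨t, ht, τ, hτmem, h.1, h.2⟩
  · refine ⟨(τ - τ₀) ^ 2 * κ / (4 * τ * τ₀), ?_, ?_, hlate, hM⟩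
    · exact div_nonneg (by positivity) (mul_nonneg (by positivity) hτ₀.1)
    -- For `τ₀ = 0` the quotient is a division by zero, but the factor `τ * τ₀` already makes the
    -- left side vanish.
    · rcases hτ₀.1.eq_or_lt with rfl | hpos
      · simp only [mul_zero]
        positivity
      · exact le_of_eq (by field_simp)

/-- A negative value would force a zero of `ψ` further right by the intermediate value theorem,
against `κ ≤ |ψ|`. -/
theorem pos_of_le_abs {τ τ₀ κ : ℝ} {ψ : ℝ → ℝ} (hψ : ContinuousOn ψ (Icc τ₀ τ)) (hκ : 0 < κ)
    (hlate : ∀ t ∈ Icc τ₀ τ, κ ≤ |ψ t|) (hpos : 0 < ψ τ) : ∀ t ∈ Icc τ₀ τ, κ ≤ ψ t := by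
  intro t ht
  have h := hlate t ht
  rcases le_abs'.1 h with hneg | h
  · have hsub : Icc t τ ⊆ Icc τ₀ τ := Icc_subset_Icc_left ht.1
    obtain ⟨s, hs, hs0⟩ := intermediate_value_Icc ht.2 (hψ.mono hsub)
      (show (0 : ℝ) ∈ Icc (ψ t) (ψ τ) from ⟨by linarith, hpos.le⟩)
    have := hlate s (hsub hs)
    rw [hs0, abs_zero] at this
    linarith
  · exact h

/-- A lower bound for `mu` under the bounds of `TimeFactorAssumption.exists_bound`, for `ψ` with
positive final value. -/
theorem const_div_sq_le_mu {τ τ₀ κ M m lam : ℝ} {ψ : ℝ → ℝ} (hψ : ContinuousOn ψ (Icc 0 τ))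
    (hτ₀ : τ₀ ∈ Ico 0 τ) (hκ : 0 < κ) (hM : 0 ≤ M)
    (hMκ : M * (τ * τ₀) ≤ (τ - τ₀) ^ 2 * κ / 4) (hlate : ∀ t ∈ Icc τ₀ τ, κ ≤ |ψ t|)
    (hopp : ∀ t ∈ Icc 0 τ, ψ t * ψ τ ≤ 0 → |ψ t| ≤ M) (hpos : 0 < ψ τ) (hm : 0 < m)
    (h : m ≤ lam) :
    κ / 2 * (Real.exp (-1) * (min ((τ - τ₀) * m) 1 ^ 2 / 2)) / lam ^ 2 ≤ mu ψ lam τ := by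
  refine le_trans ?_ (half_integral_kernel_le_mu hψ hτ₀ hM hMκ hκ.le
    (pos_of_le_abs (hψ.mono (Icc_subset_Icc_left hτ₀.1)) hκ hlate hpos) (fun t ht => ?_)
    (hm.le.trans h))
  · have := const_div_sq_le_integral_kernel (τ := τ) (sub_pos.2 hτ₀.2) hm h
    rw [sub_sub_cancel] at this
    rw [mul_div_assoc]
    gcongr
  · rcases le_total (ψ t) 0 with hle | hle
    · exact (abs_le.1 (hopp t ⟨ht.1, ht.2.trans hτ₀.2.le⟩
        (mul_nonpos_of_nonpos_of_nonneg hle hpos.le))).1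
    · linarith

theorem TimeFactorAssumption.exists_const_div_sq_le_abs_mu {τ m : ℝ} {ψ : ℝ → ℝ}
    (hψ : ContinuousOn ψ (Icc 0 τ)) (h : TimeFactorAssumption τ ψ) (hm : 0 < m) :
    ∃ C > 0, ∀ lam, m ≤ lam → C / lam ^ 2 ≤ |mu ψ lam τ| := by
  obtain ⟨τ₀, hτ₀, κ, hκ, M, hM, hMκ, hlate, hopp⟩ := h.exists_bound
  have hmin : 0 < min ((τ - τ₀) * m) 1 := lt_min (mul_pos (sub_pos.2 hτ₀.2) hm) one_pos
  refine ⟨κ / 2 * (Real.exp (-1) * (min ((τ - τ₀) * m) 1 ^ 2 / 2)), by positivity,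
    fun lam hlam => ?_⟩
  have hψτ : ψ τ ≠ 0 := abs_pos.1 (hκ.trans_le (hlate τ ⟨hτ₀.2.le, le_rfl⟩))
  -- The bounds are invariant under `ψ ↦ -ψ`, so the case of positive final value suffices.
  rcases hψτ.lt_or_gt with hneg | hpos
  · rw [← abs_neg, ← mu_neg]
    exact (const_div_sq_le_mu (ψ := -ψ) hψ.neg hτ₀ hκ hM hMκ (by simpa using hlate)
      (by simpa using hopp) (by simpa using hneg) hm hlam).trans (le_abs_self _)
  · exact (const_div_sq_le_mu hψ hτ₀ hκ hM hMκ hlate hopp hpos hm hlam).trans (le_abs_self _)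

/-! ### Poincaré inequality and positivity of the eigenvalues -/

theorem inner_gradient_eq_fderiv {E : Type*} [NormedAddCommGroup E] [InnerProductSpace ℝ E]
    [CompleteSpace E] (f : E → ℝ) (x v : E) : inner ℝ (gradient f x) v = fderiv ℝ f x v := by
  rw [gradient, InnerProductSpace.toDual_symm_apply]

namespace IsTestFunction

variable {d : ℕ} {Ω : Set (EuclideanSpace ℝ (Fin d))} {η : EuclideanSpace ℝ (Fin d) → ℝ}

theorem continuous_fderiv (h : IsTestFunction Ω η) : Continuous (fderiv ℝ η) :=
  h.contDiff.continuous_fderiv (by simp)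

theorem continuous_gradient (h : IsTestFunction Ω η) : Continuous (gradient η) :=
  (InnerProductSpace.toDual ℝ _).symm.continuous.comp h.continuous_fderiv

theorem hasCompactSupport_gradient (h : IsTestFunction Ω η) : HasCompactSupport (gradient η) :=
  (h.hasCompactSupport.fderiv (𝕜 := ℝ)).comp_left
    (g := (InnerProductSpace.toDual ℝ (EuclideanSpace ℝ (Fin d))).symm) (map_zero _)

theorem memLp (h : IsTestFunction Ω η) (μ : Measure (EuclideanSpace ℝ (Fin d)))
    [IsFiniteMeasureOnCompacts μ] : MemLp η 2 μ :=
  h.contDiff.continuous.memLp_of_hasCompactSupport h.hasCompactSupport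

theorem memLp_gradient (h : IsTestFunction Ω η) (μ : Measure (EuclideanSpace ℝ (Fin d)))
    [IsFiniteMeasureOnCompacts μ] : MemLp (gradient η) 2 μ :=
  h.continuous_gradient.memLp_of_hasCompactSupport h.hasCompactSupport_gradient

/-- Integration by parts against a coordinate function. -/
theorem integral_sq_eq (h : IsTestFunction Ω η) (i : Fin d) :
    ∫ x, η x ^ 2 = -∫ x, x i * (2 * η x * fderiv ℝ η x (EuclideanSpace.single i 1)) := by
  set e : EuclideanSpace ℝ (Fin d) := EuclideanSpace.single i 1
  have hηc := h.contDiff.continuous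
  have hdiff : Differentiable ℝ η := h.contDiff.differentiable (by simp)
  have hcoord : ∀ x, HasFDerivAt (fun x : EuclideanSpace ℝ (Fin d) => x i)
      (EuclideanSpace.proj i : EuclideanSpace ℝ (Fin d) →L[ℝ] ℝ) x :=
    fun x => (EuclideanSpace.proj i : EuclideanSpace ℝ (Fin d) →L[ℝ] ℝ).hasFDerivAt
  have hcc : Continuous fun x : EuclideanSpace ℝ (Fin d) => x i :=
    (EuclideanSpace.proj i : EuclideanSpace ℝ (Fin d) →L[ℝ] ℝ).continuous
  have hfd : ∀ x, fderiv ℝ (fun x : EuclideanSpace ℝ (Fin d) => x i) x e = 1 := fun x => by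
    rw [(hcoord x).fderiv]
    simp [e]
  have hsq : ∀ x, fderiv ℝ (fun x => η x ^ 2) x e = 2 * η x * fderiv ℝ η x e := fun x => by
    rw [((hdiff x).hasFDerivAt.pow 2).fderiv]
    simp
  have hfe : Continuous fun x => fderiv ℝ η x e := h.continuous_fderiv.clm_apply continuous_const
  have hs2 : HasCompactSupport fun x => η x ^ 2 :=
    h.hasCompactSupport.comp_left (g := fun y : ℝ => y ^ 2) (by simp)
  have hsd : HasCompactSupport fun x => 2 * η x * fderiv ℝ η x e :=
    (h.hasCompactSupport.mul_left (f := fun _ => (2 : ℝ))).mul_right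
  have key := integral_mul_fderiv_eq_neg_fderiv_mul_of_integrable (μ := volume) (v := e)
    (f := fun x : EuclideanSpace ℝ (Fin d) => x i) (g := fun x => η x ^ 2)
    (by
      simp only [hfd, one_mul]
      exact (hηc.pow 2).integrable_of_hasCompactSupport hs2)
    (by
      simp only [hsq]
      exact (hcc.mul ((continuous_const.mul hηc).mul hfe)).integrable_of_hasCompactSupport
        hsd.mul_left)
    ((hcc.mul (hηc.pow 2)).integrable_of_hasCompactSupport hs2.mul_left)
    (fun x _ => (hcoord x).differentiableAt) (fun x _ => (hdiff x).pow 2)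
  simp only [hfd, hsq, one_mul] at key
  rw [key, neg_neg]

/-- The Poincaré inequality for test functions. -/
theorem integral_sq_le (h : IsTestFunction Ω η) (i : Fin d) {R : ℝ} (hR : ∀ x ∈ Ω, ‖x‖ ≤ R) :
    ∫ x, η x ^ 2 ≤ 4 * R ^ 2 * ∫ x, ‖gradient η x‖ ^ 2 := by
  have h1 : Integrable fun x => η x ^ 2 := (h.memLp volume).integrable_sq
  have h2 : Integrable fun x => ‖gradient η x‖ ^ 2 := (h.memLp_gradient volume).norm.integrable_sq
  have hmono : ∫ x, -(x i * (2 * η x * fderiv ℝ η x (EuclideanSpace.single i 1))) ≤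
      ∫ x, (1 / 2 * η x ^ 2 + 2 * R ^ 2 * ‖gradient η x‖ ^ 2) := by
    refine integral_mono ?_ ((h1.const_mul _).add (h2.const_mul _)) fun x => ?_
    · have hcc : Continuous fun x : EuclideanSpace ℝ (Fin d) => x i :=
        (EuclideanSpace.proj i : EuclideanSpace ℝ (Fin d) →L[ℝ] ℝ).continuous
      have hfe : Continuous fun x => fderiv ℝ η x (EuclideanSpace.single i 1) :=
        h.continuous_fderiv.clm_apply continuous_const
      exact (hcc.mul ((continuous_const.mul h.contDiff.continuous).mul hfe)
        |>.integrable_of_hasCompactSupport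
          (h.hasCompactSupport.mul_left (f := fun _ => (2 : ℝ))).mul_right.mul_left).neg
    · have hD : fderiv ℝ η x (EuclideanSpace.single i 1) ^ 2 ≤ ‖gradient η x‖ ^ 2 := by
        rw [← inner_gradient_eq_fderiv]
        refine sq_le_sq.2 ?_
        rw [abs_norm]
        simpa using abs_real_inner_le_norm (gradient η x) (EuclideanSpace.single i (1 : ℝ))
      by_cases hx : x ∈ Ω
      · have hxi : x i ^ 2 ≤ R ^ 2 :=
          sq_le_sq' (abs_le.1 ((PiLp.norm_apply_le x i).trans (hR x hx))).1
            (abs_le.1 ((PiLp.norm_apply_le x i).trans (hR x hx))).2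
        have := mul_le_mul hxi hD (sq_nonneg _) (sq_nonneg R)
        dsimp only
        -- Young's inequality, weighted so that `η²/2` can be absorbed on the left; this gives the
        -- constant `4 R²`.
        nlinarith [sq_nonneg (η x + 2 * (x i * fderiv ℝ η x (EuclideanSpace.single i 1)))]
      · have : η x = 0 := image_eq_zero_of_notMem_tsupport fun hx' => hx (h.tsupport_subset hx')
        simp only [this, mul_zero, zero_mul, neg_zero]
        positivity
  rw [integral_neg, ← h.integral_sq_eq i, integral_add (h1.const_mul _) (h2.const_mul _),
    integral_const_mul, integral_const_mul] at hmono
  linarith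

/-- Since `η` and its gradient vanish off `Ω`, the whole-space inequality becomes one between
`L²(Ω)` norms, which survives limits. -/
theorem norm_toLp_sq_le (h : IsTestFunction Ω η) (i : Fin d) {R : ℝ} (hR : ∀ x ∈ Ω, ‖x‖ ≤ R) :
    ‖(h.memLp (volume.restrict Ω)).toLp η‖ ^ 2 ≤
      4 * R ^ 2 * ‖(h.memLp_gradient (volume.restrict Ω)).toLp (gradient η)‖ ^ 2 := by
  rw [← real_inner_self_eq_norm_sq, ← real_inner_self_eq_norm_sq, L2.inner_def, L2.inner_def]
  have e1 : ∫ x in Ω, inner ℝ ((h.memLp (volume.restrict Ω)).toLp η x)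
      ((h.memLp (volume.restrict Ω)).toLp η x) = ∫ x, η x ^ 2 := by
    rw [← setIntegral_eq_integral_of_forall_compl_eq_zero (s := Ω) (f := fun x => η x ^ 2)
        fun x hx => by
      rw [image_eq_zero_of_notMem_tsupport fun hx' => hx (h.tsupport_subset hx')]; simp]
    refine integral_congr_ae ?_
    filter_upwards [(h.memLp (volume.restrict Ω)).coeFn_toLp] with x hx
    rw [hx, real_inner_self_eq_norm_sq, Real.norm_eq_abs, sq_abs]
  have e2 : ∫ x in Ω, inner ℝ ((h.memLp_gradient (volume.restrict Ω)).toLp (gradient η) x)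
      ((h.memLp_gradient (volume.restrict Ω)).toLp (gradient η) x) =
      ∫ x, ‖gradient η x‖ ^ 2 := by
    rw [← setIntegral_eq_integral_of_forall_compl_eq_zero (s := Ω)
        (f := fun x => ‖gradient η x‖ ^ 2) fun x hx => by
      have : fderiv ℝ η x = 0 := image_eq_zero_of_notMem_tsupport fun hx' =>
        hx (h.tsupport_subset (tsupport_fderiv_subset ℝ hx'))
      simp [gradient, this]]
    refine integral_congr_ae ?_
    filter_upwards [(h.memLp_gradient (volume.restrict Ω)).coeFn_toLp] with x hx
    rw [hx, real_inner_self_eq_norm_sq]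
  rw [e1, e2]
  exact h.integral_sq_le i hR

end IsTestFunction

/-- On a bounded set, a nonzero weak solution of the Dirichlet eigenvalue problem has a positive
eigenvalue. -/
theorem IsDirichletSolution.pos {d : ℕ} {Ω : Set (EuclideanSpace ℝ (Fin d))} (i : Fin d)
    (hΩ : Bornology.IsBounded Ω) {ev : ℝ} {v : L2 Ω} (h : IsDirichletSolution Ω ev v)
    (hv : v ≠ 0) : 0 < ev := by
  obtain ⟨G, ⟨hvm, hGm, η, hη, hηv, hηG⟩, hweak⟩ := h
  obtain ⟨R, hR⟩ := hΩ.exists_norm_le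
  have hlimv : Tendsto (fun k => ((hη k).memLp (volume.restrict Ω)).toLp (η k)) atTop (𝓝 v) := by
    have := (Lp.tendsto_Lp_iff_tendsto_eLpNorm'' η (fun k => (hη k).memLp _) v hvm).2 hηv
    rwa [Lp.toLp_coeFn] at this
  have hlimG : Tendsto (fun k => ((hη k).memLp_gradient (volume.restrict Ω)).toLp (gradient (η k)))
      atTop (𝓝 (hGm.toLp G)) :=
    (Lp.tendsto_Lp_iff_tendsto_eLpNorm'' _ (fun k => (hη k).memLp_gradient _) G hGm).2 hηG
  have hpoinc : ‖v‖ ^ 2 ≤ 4 * R ^ 2 * ‖hGm.toLp G‖ ^ 2 :=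
    le_of_tendsto_of_tendsto' (hlimv.norm.pow 2) ((hlimG.norm.pow 2).const_mul _)
      fun k => (hη k).norm_toLp_sq_le i hR
  -- The solution is its own test function in the limit: test with `η k` and let `k → ∞`.
  have henergy : ‖hGm.toLp G‖ ^ 2 = ev * ‖v‖ ^ 2 := by
    rw [← real_inner_self_eq_norm_sq, ← real_inner_self_eq_norm_sq]
    refine tendsto_nhds_unique (tendsto_const_nhds.inner hlimG)
      (Tendsto.congr (fun k => ?_) ((tendsto_const_nhds.inner hlimv).const_mul ev))
    rw [L2.inner_def, L2.inner_def]
    have e1 : ∫ x in Ω, inner ℝ (v x) (((hη k).memLp (volume.restrict Ω)).toLp (η k) x) =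
        ∫ x in Ω, v x * η k x := by
      refine integral_congr_ae ?_
      filter_upwards [((hη k).memLp (volume.restrict Ω)).coeFn_toLp] with x hx
      rw [hx, real_inner_eq_re_inner, RCLike.inner_apply']; simp
    have e2 : ∫ x in Ω, inner ℝ (hGm.toLp G x)
        (((hη k).memLp_gradient (volume.restrict Ω)).toLp (gradient (η k)) x) =
        ∫ x in Ω, inner ℝ (G x) (gradient (η k) x) := by
      refine integral_congr_ae ?_
      filter_upwards [((hη k).memLp_gradient (volume.restrict Ω)).coeFn_toLp, hGm.coeFn_toLp]
        with x hx hx'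
      rw [hx, hx']
    rw [e1, e2, hweak _ (hη k)]
  rw [henergy] at hpoinc
  have hv' : 0 < ‖v‖ ^ 2 := by positivity
  by_contra! hev
  have : 4 * R ^ 2 * (ev * ‖v‖ ^ 2) ≤ 0 :=
    mul_nonpos_of_nonneg_of_nonpos (by positivity)
      (mul_nonpos_of_nonpos_of_nonneg hev hv'.le)
  linarith

/-! ### Coefficient expansions, interpolation and stability -/

/-- Multiplying Hilbert basis coefficients by a bounded sequence gives a convergent expansion. -/
theorem HilbertBasis.inner_tsum_mul_inner_smul {E : Type*} [NormedAddCommGroup E]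
    [InnerProductSpace ℝ E] (φ : HilbertBasis ℕ ℝ E) {c : ℕ → ℝ} {B : ℝ}
    (hc : ∀ n, |c n| ≤ B) (f : E) (n : ℕ) :
    inner ℝ (∑' n, (c n * inner ℝ f (φ n)) • φ n) (φ n) = c n * inner ℝ f (φ n) := by
  have hsum : Summable fun n => inner ℝ f (φ n) ^ 2 := by
    simpa [pow_two, real_inner_comm] using φ.summable_inner_mul_inner f f
  have hmem : Memℓp (fun n => c n * inner ℝ f (φ n)) 2 := by
    refine memℓp_gen ?_
    refine Summable.of_nonneg_of_le (fun n => by positivity) (fun n => ?_) (hsum.mul_left (B ^ 2))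
    rw [ENNReal.toReal_ofNat, Real.rpow_two, Real.norm_eq_abs, sq_abs, mul_pow]
    exact mul_le_mul_of_nonneg_right (sq_le_sq' (abs_le.1 (hc n)).1 (abs_le.1 (hc n)).2)
      (sq_nonneg _)
  have h := (φ.hasSum_repr_symm ⟨_, hmem⟩).tsum_eq
  rw [real_inner_comm, ← φ.repr_apply_apply]
  exact (congrArg (fun u => φ.repr u n) h).trans (by simp)

theorem HilbertBasis.hasSum_inner_sq {E : Type*} [NormedAddCommGroup E]
    [InnerProductSpace ℝ E] (φ : HilbertBasis ℕ ℝ E) (f : E) :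
    HasSum (fun n => inner ℝ f (φ n) ^ 2) (‖f‖ ^ 2) := by
  rw [← real_inner_self_eq_norm_sq]
  simpa [pow_two, real_inner_comm] using φ.hasSum_inner_mul_inner f f

/-- Interpolation between the weights `λ^{2p}` and `λ⁻⁴`. -/
theorem tsum_sq_le_interpolation {lam a : ℕ → ℝ} {p A : ℝ} (hlam : ∀ n, 0 < lam n) (hp : 0 < p)
    (hS : Summable fun n => lam n ^ (2 * p) * a n ^ 2)
    (hA : ∑' n, lam n ^ (2 * p) * a n ^ 2 ≤ A)
    {b : ℕ → ℝ} (hb : ∀ n, |a n| / lam n ^ 2 ≤ |b n|) (hbs : Summable fun n => b n ^ 2) :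
    ∑' n, a n ^ 2 ≤ A ^ (2 / (p + 2)) * (∑' n, b n ^ 2) ^ (p / (p + 2)) := by
  have hp2 : 0 < p + 2 := by linarith
  have hconj : ((p + 2) / 2).HolderConjugate ((p + 2) / p) := by
    rw [Real.holderConjugate_iff]
    exact ⟨by linarith, by field_simp; ring⟩
  have hF : ∀ n, 0 ≤ lam n ^ (2 * p) * a n ^ 2 := fun n =>
    mul_nonneg (Real.rpow_nonneg (hlam n).le _) (sq_nonneg _)
  have hFP : ∀ n, ((lam n ^ (2 * p) * a n ^ 2) ^ (2 / (p + 2))) ^ ((p + 2) / 2) =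
      lam n ^ (2 * p) * a n ^ 2 := fun n => by
    rw [← Real.rpow_mul (hF n), div_mul_div_cancel₀ hp2.ne', div_self two_ne_zero, Real.rpow_one]
  have hGQ : ∀ n, ((b n ^ 2) ^ (p / (p + 2))) ^ ((p + 2) / p) = b n ^ 2 := fun n => by
    rw [← Real.rpow_mul (sq_nonneg _), div_mul_div_cancel₀ hp2.ne', div_self hp.ne', Real.rpow_one]
  -- The exponents `2/(p+2)` and `p/(p+2)` sum to 1 and cancel the powers of `lam n`: both weights
  -- contribute `4p/(p+2)`, with opposite signs.
  have hpoint : ∀ n, a n ^ 2 ≤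
      (lam n ^ (2 * p) * a n ^ 2) ^ (2 / (p + 2)) * (b n ^ 2) ^ (p / (p + 2)) := fun n => by
    have hl := hlam n
    have hab : a n ^ 2 / lam n ^ (4 : ℝ) ≤ b n ^ 2 := by
      have := pow_le_pow_left₀ (by positivity) (hb n) 2
      rw [div_pow, sq_abs, sq_abs, ← pow_mul] at this
      exact_mod_cast this
    calc a n ^ 2 = (lam n ^ (2 * p) * a n ^ 2) ^ (2 / (p + 2)) *
          (a n ^ 2 / lam n ^ (4 : ℝ)) ^ (p / (p + 2)) := by
          rw [Real.mul_rpow (by positivity) (sq_nonneg _),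
            Real.div_rpow (sq_nonneg _) (by positivity), ← Real.rpow_mul hl.le,
            ← Real.rpow_mul hl.le, show 2 * p * (2 / (p + 2)) = 4 * (p / (p + 2)) by ring]
          have hadd : (a n ^ 2) ^ (2 / (p + 2)) * (a n ^ 2) ^ (p / (p + 2)) = a n ^ 2 := by
            rw [← Real.rpow_add_of_nonneg (sq_nonneg _) (by positivity) (by positivity),
              ← add_div, add_comm, div_self hp2.ne', Real.rpow_one]
          have hne : lam n ^ (4 * (p / (p + 2))) ≠ 0 := (Real.rpow_pos_of_pos hl _).ne'
          field_simp
          exact hadd.symm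
      _ ≤ _ := by gcongr
  obtain ⟨hsum, hle⟩ := Real.summable_and_inner_le_Lp_mul_Lq_tsum_of_nonneg hconj
    (f := fun n => (lam n ^ (2 * p) * a n ^ 2) ^ (2 / (p + 2)))
    (g := fun n => (b n ^ 2) ^ (p / (p + 2)))
    (fun n => Real.rpow_nonneg (hF n) _) (fun n => Real.rpow_nonneg (sq_nonneg _) _)
    (by simpa only [hFP] using hS) (by simpa only [hGQ] using hbs)
  simp only [hFP, hGQ, one_div_div] at hle
  calc ∑' n, a n ^ 2 ≤ _ :=
        (Summable.of_nonneg_of_le (fun n => sq_nonneg _) hpoint hsum).tsum_le_tsum hpoint hsum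
    _ ≤ _ := hle
    _ ≤ _ := mul_le_mul_of_nonneg_right
        (Real.rpow_le_rpow (tsum_nonneg hF) hA (by positivity))
        (Real.rpow_nonneg (tsum_nonneg fun n => sq_nonneg _) _)

theorem theorem3p2 {d : ℕ} (hd : 1 ≤ d) (Ω : Set (EuclideanSpace ℝ (Fin d)))
    (hΩ_open : IsOpen Ω) (hΩ_conn : IsConnected Ω) (hΩ_bdd : Bornology.IsBounded Ω)
    (τ : ℝ) (hτ : 0 < τ) (ψ : ℝ → ℝ) (hψ : ContinuousOn ψ (Set.Icc 0 τ))
    (hψA : TimeFactorAssumption τ ψ)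
    (lam : ℕ → ℝ) (φ : HilbertBasis ℕ ℝ (L2 Ω)) (hφ : IsDirichletEigensystem Ω lam φ) :
    (∃ C : ℝ, 0 < C ∧ ∀ n, C / lam n ^ 2 ≤ |mu ψ (lam n) τ|) ∧
    ∀ C : ℝ, 0 < C → (∀ n, C / lam n ^ 2 ≤ |mu ψ (lam n) τ|) →
      ∀ ϱ p : ℝ, 0 < ϱ → 0 < p → ∀ f h : L2 Ω,
        f ∈ sourceSet lam φ ϱ p → sourceToFinal τ ψ lam φ f = h →
          ‖f‖ ≤ C ^ (-(p / (p + 2))) * ϱ ^ (2 / (p + 2)) * ‖h‖ ^ (p / (p + 2)) := by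
  have hlam : ∀ n, 0 < lam n := fun n =>
    (hφ.eigen n).pos ⟨0, hd⟩ hΩ_bdd (φ.orthonormal.ne_zero n)
  refine ⟨?_, ?_⟩
  · obtain ⟨C, hC, hCmu⟩ := hψA.exists_const_div_sq_le_abs_mu hψ (hlam 0)
    exact ⟨C, hC, fun n => hCmu _ (hφ.monotone (Nat.zero_le n))⟩
  rintro C hC hCmu ϱ p hϱ hp f h ⟨hfS, hfle⟩ rfl
  obtain ⟨B, hB⟩ := isCompact_Icc.exists_bound_of_continuousOn hψ
  have hcoef : ∀ n, inner ℝ (sourceToFinal τ ψ lam φ f) (φ n) =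
      mu ψ (lam n) τ * inner ℝ f (φ n) := fun n =>
    φ.inner_tsum_mul_inner_smul (fun n => abs_mu_le hτ.le hB (hlam n).le) f n
  set h := sourceToFinal τ ψ lam φ f
  have hhs : HasSum (fun n => (inner ℝ h (φ n) / C) ^ 2) (‖h‖ ^ 2 / C ^ 2) := by
    simpa only [div_pow] using (φ.hasSum_inner_sq h).div_const (C ^ 2)
  simp only [sq_abs] at hfS hfle
  -- Dividing the coefficients of `h` by `C` normalises the lower bound on `mu`, and accounts for
  -- the power of `C` in the estimate.
  have key := tsum_sq_le_interpolation hlam hp hfS hfle (b := fun n => inner ℝ h (φ n) / C)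
    (fun n => by
      rw [hcoef, abs_div, abs_mul, abs_of_pos hC, le_div_iff₀ hC]
      calc |inner ℝ f (φ n)| / lam n ^ 2 * C = C / lam n ^ 2 * |inner ℝ f (φ n)| := by ring
        _ ≤ _ := mul_le_mul_of_nonneg_right (hCmu n) (abs_nonneg _)) hhs.summable
  rw [hhs.tsum_eq, (φ.hasSum_inner_sq f).tsum_eq, ← div_pow] at key
  rw [← pow_le_pow_iff_left₀ (norm_nonneg _) (by positivity) two_ne_zero]
  refine key.trans (le_of_eq ?_)
  rw [← Real.rpow_pow_comm hϱ.le, ← Real.rpow_pow_comm (by positivity),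
    Real.div_rpow (norm_nonneg _) hC.le, Real.rpow_neg hC.le]
  ring
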